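/- Let $d\ge 2$ and let $|\cdot|$ denote the sup-norm on $\mathbb{R}^d$. Let $\mathcal{T}=\{\tau\in\mathbb{R}^d : \tau_1+\dots+\tau_d=0\}$, let $\mathcal{B}=\{x\in\mathbb{R}^d : |x|\le 1\}$, and for $\tau\in\mathcal{T}$ put $\mathcal{B}_\tau=\mathrm{diag}(e^{\tau_1},\dots,e^{\tau_d})\,\mathcal{B}$. For a lattice $\Lambda\subset\mathbb{R}^d$ of full rank and $1\le k\le d$, let $\lambda_k(\mathcal{B}_\tau,\Lambda)$ be the $k$-th successive minimum, i.e. the infimum of all $\lambda>0$ such that $\lambda\mathcal{B}_\tau$ contains at least $k$ linearly independent vectors of $\Lambda$, and let $L_k(\tau,\Lambda)=\log\lambda_k(\mathcal{B}_\tau,\Lambda)$. Let $\Lambda^*=\{y\in\mathbb{R}^d : \langle y,x\rangle\in\mathbb{Z}\text{ for each }x\in\Lambda\}$ be the dual lattice. For a non-negative function $f:\mathcal{T}\to\mathbb{R}$ whose sublevel sets $\{\tau\in\mathcal{T} : f(\tau)\le c\}$, $c\in\mathbb{R}$, are all bounded (so that they form a monotone exhaustion of $\mathcal{T}$ by bounded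 sets), define $$\underline{\Psi}_k(\Lambda,f)=\liminf_{|\tau|\to\infty,\ \tau\in\mathcal{T}}\ \sum_{1\le j\le k}\frac{L_j(\tau,\Lambda)}{f(\tau)}\in[-\infty,+\infty],$$ and let $f^*(\tau)=f(-\tau)$. Theorem. For every lattice $\Lambda\subset\mathbb{R}^d$ of full rank with covolume $1$ and every such function $f$, $$\underline{\Psi}_1(\Lambda,f)\le\frac{\underline{\Psi}_1(\Lambda^*,f^*)}{d-1}.$$ -/

import Mathlib

open scoped Pointwise

noncomputable section

/-- The hyperplane `𝒯 = {τ ∈ ℝ^d : τ_1 + ... + τ_d = 0}`, with the sup-norm induced from `ℝ^d`. -/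
def traceZero (d : ℕ) : Submodule ℝ (Fin d → ℝ) where
  carrier := {τ | ∑ i, τ i = 0}
  add_mem' {a b} ha hb := by
    simp only [Set.mem_ofPred_eq] at ha hb ⊢
    simp [Finset.sum_add_distrib, ha, hb]
  zero_mem' := by simp
  smul_mem' c a ha := by
    simp only [Set.mem_ofPred_eq] at ha ⊢
    simp [← Finset.mul_sum, ha]

/-- `Λ` is a full-rank lattice in `ℝ^d` of covolume `1`. -/
structure IsUnimodularLattice {d : ℕ} (Λ : Submodule ℤ (Fin d → ℝ)) : Prop where
  discrete : DiscreteTopology Λ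
  isZLattice : IsZLattice ℝ Λ
  covolume_eq_one : ZLattice.covolume Λ MeasureTheory.volume = 1

/-- The dual lattice `Λ* = {y ∈ ℝ^d : ⟨y, x⟩ ∈ ℤ for each x ∈ Λ}`. -/
def dualLattice {d : ℕ} (Λ : Submodule ℤ (Fin d → ℝ)) : Submodule ℤ (Fin d → ℝ) :=
  LinearMap.BilinForm.dualSubmodule (dotProductBilin ℝ ℝ) Λ

theorem mem_dualLattice {d : ℕ} {Λ : Submodule ℤ (Fin d → ℝ)} {y : Fin d → ℝ} :
    y ∈ dualLattice Λ ↔ ∀ x ∈ Λ, ∃ n : ℤ, (n : ℝ) = ∑ i, y i * x i := by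
  simp [dualLattice, LinearMap.BilinForm.mem_dualSubmodule, Submodule.mem_one, dotProduct]

/-- The parallelepiped `D_τ ℬ`, where `ℬ` is the closed unit ball of the sup-norm and
`D_τ = diag(e^{τ_1}, ..., e^{τ_d})`. -/
def paramBox {d : ℕ} (τ : Fin d → ℝ) : Set (Fin d → ℝ) :=
  (fun x => Matrix.mulVec (Matrix.diagonal fun i => Real.exp (τ i)) x) ''
    Metric.closedBall (0 : Fin d → ℝ) 1

/-- The `k`-th successive minimum of `B` with respect to `Λ`: the infimum of the positive `c` such
that `c B` contains at least `k` linearly independent vectors of `Λ`. -/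
def successiveMin {d : ℕ} (k : ℕ) (B : Set (Fin d → ℝ)) (Λ : Submodule ℤ (Fin d → ℝ)) : ℝ :=
  sInf {c : ℝ | 0 < c ∧ ∃ v : Fin k → (Fin d → ℝ),
    LinearIndependent ℝ v ∧ ∀ i, v i ∈ Λ ∧ v i ∈ c • B}

/-- `L_k(τ, Λ) = log λ_k(D_τ ℬ, Λ)`. -/
def logMin {d : ℕ} (k : ℕ) (τ : traceZero d) (Λ : Submodule ℤ (Fin d → ℝ)) : ℝ :=
  Real.log (successiveMin k (paramBox (τ : Fin d → ℝ)) Λ)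

/-- A non-negative function on `𝒯` whose sublevel sets form an exhaustion of `𝒯`
by bounded sets. (That the sublevel sets increase and cover `𝒯` holds for any real function.) -/
structure IsExhaustionFunction {d : ℕ} (f : traceZero d → ℝ) : Prop where
  nonneg : ∀ τ, 0 ≤ f τ
  isBounded_sublevel : ∀ c : ℝ, Bornology.IsBounded {τ | f τ ≤ c}

/-- `f*(τ) = f(-τ)`. -/
def conjFun {d : ℕ} (f : traceZero d → ℝ) : traceZero d → ℝ := fun τ => f (-τ)

/-- `ψ_k(τ, Λ, f) = L_k(τ, Λ) / f(τ)`. -/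
def psiFun {d : ℕ} (k : ℕ) (τ : traceZero d) (Λ : Submodule ℤ (Fin d → ℝ))
    (f : traceZero d → ℝ) : ℝ :=
  logMin k τ Λ / f τ

/-- `Ψ_k(τ, Λ, f) = ∑_{1 ≤ j ≤ k} ψ_j(τ, Λ, f)`. -/
def PsiFun {d : ℕ} (k : ℕ) (τ : traceZero d) (Λ : Submodule ℤ (Fin d → ℝ))
    (f : traceZero d → ℝ) : ℝ :=
  ∑ j ∈ Finset.Icc 1 k, psiFun j τ Λ f

/-- The Schmidt--Summerer lower exponent of the second type: the lower limit of `Ψ_k(τ, Λ, f)` as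
`|τ| → ∞` in `𝒯`, an element of `[-∞, +∞]`. -/
def lowerPsi {d : ℕ} (k : ℕ) (Λ : Submodule ℤ (Fin d → ℝ)) (f : traceZero d → ℝ) : EReal :=
  Filter.liminf (fun τ : traceZero d => ((PsiFun k τ Λ f : ℝ) : EReal))
    (Bornology.cobounded (traceZero d))

end

/-! A short dual vector `y` confines lattice points to parallel hyperplanes `⟨y, x⟩ = n`. If `y`
lies in the `c`-dilate of the box with exponents `-τ`, Minkowski's theorem applied to a slab `|⟨y,
x⟩| < 1` cut by `d - 1` coordinate constraints of size `C`, with `C ^ (d - 1) > c`, gives a nonzero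
`x ∈ Λ` on the hyperplane `⟨y, x⟩ = 0`. Orthogonality bounds the missing coordinate
(`exists_lattice_point_of_dual_point`). In logarithms, `L₁(-τ, Λ)` is at most `L₁(τ, Λ*) / (d - 1)`
plus a constant (`logMin_le_logMin_dualLattice`). Dividing by `f(-τ) = f*(τ)`, which tends to
infinity, removes the constant. -/

/-- Membership in a dilated parametric box, in coordinates. -/
theorem mem_smul_paramBox_iff {d : ℕ} {τ : Fin d → ℝ} {c : ℝ} (hc : 0 < c) {x : Fin d → ℝ} :
    x ∈ c • paramBox τ ↔ ∀ i, |x i| ≤ c * Real.exp (τ i) := by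
  simp only [paramBox, Set.mem_smul_set, Set.mem_image, mem_closedBall_zero_iff]
  constructor
  · rintro ⟨_, ⟨z, hz, rfl⟩, rfl⟩ i
    have hzi : |z i| ≤ 1 := (norm_le_pi_norm z i).trans hz
    rw [Pi.smul_apply, Matrix.mulVec_diagonal, smul_eq_mul, abs_mul, abs_mul, abs_of_pos hc,
      Real.abs_exp]
    have := Real.exp_pos (τ i)
    gcongr
    exact mul_le_of_le_one_right this.le hzi
  · intro h
    refine ⟨fun i => c⁻¹ * x i, ⟨fun i => (c * Real.exp (τ i))⁻¹ * x i, ?_, ?_⟩, ?_⟩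
    · refine (pi_norm_le_iff_of_nonneg zero_le_one).2 fun i => ?_
      have hpos : 0 < c * Real.exp (τ i) := mul_pos hc (Real.exp_pos _)
      rw [Real.norm_eq_abs, abs_mul, abs_of_pos (inv_pos.2 hpos), inv_mul_le_iff₀ hpos, mul_one]
      exact h i
    · ext i
      rw [Matrix.mulVec_diagonal]
      have := (Real.exp_pos (τ i)).ne'
      field_simp
    · ext i
      simp [hc.ne']

/-- The first successive minimum of a parametric box, in terms of nonzero lattice points. -/
theorem successiveMin_one_paramBox {d : ℕ} (τ : Fin d → ℝ) (Λ : Submodule ℤ (Fin d → ℝ)) :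
    successiveMin 1 (paramBox τ) Λ =
      sInf {c : ℝ | 0 < c ∧ ∃ x ∈ Λ, x ≠ 0 ∧ ∀ i, |x i| ≤ c * Real.exp (τ i)} := by
  unfold successiveMin
  congr 1
  ext c
  refine and_congr_right fun hc => ⟨?_, ?_⟩
  · rintro ⟨v, hv, h⟩
    exact ⟨v 0, (h 0).1, hv.ne_zero 0, (mem_smul_paramBox_iff hc).1 (h 0).2⟩
  · rintro ⟨x, hx, hx0, h⟩
    exact ⟨fun _ => x, linearIndependent_unique_iff.2 hx0,
      fun _ => ⟨hx, (mem_smul_paramBox_iff hc).2 h⟩⟩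

/-- Every factor whose dilate of a box meets a discrete lattice nontrivially is bounded below by a
positive constant. -/
theorem exists_pos_le_of_discrete {d : ℕ} (τ : Fin d → ℝ) (Λ : Submodule ℤ (Fin d → ℝ))
    [DiscreteTopology Λ] :
    ∃ ε > 0, ∀ c : ℝ, 0 < c → ∀ x ∈ Λ, x ≠ 0 → (∀ i, |x i| ≤ c * Real.exp (τ i)) → ε ≤ c := by
  obtain ⟨ε, hε, h⟩ := Metric.isOpen_singleton_iff.1 (isOpen_discrete ({0} : Set Λ))
  refine ⟨ε * Real.exp (-‖τ‖), by positivity, fun c hc x hx hx0 hxc => ?_⟩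
  have hεx : ε ≤ ‖x‖ := by
    by_contra! hlt
    exact hx0 (congrArg Subtype.val (h ⟨x, hx⟩ (by simpa [Subtype.dist_eq] using hlt)))
  have hxn : ‖x‖ ≤ c * Real.exp ‖τ‖ := by
    refine (pi_norm_le_iff_of_nonneg (by positivity)).2 fun i => (hxc i).trans ?_
    gcongr
    exact (le_abs_self _).trans (norm_le_pi_norm τ i)
  rw [Real.exp_neg, ← div_eq_mul_inv, div_le_iff₀ (Real.exp_pos _)]
  exact hεx.trans hxn

/-- The dual of a full-rank lattice in positive dimension contains a nonzero vector. -/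
theorem exists_ne_zero_mem_dualLattice {d : ℕ} (hd : 0 < d) (Λ : Submodule ℤ (Fin d → ℝ))
    [DiscreteTopology Λ] [IsZLattice ℝ Λ] : ∃ y ∈ dualLattice Λ, y ≠ 0 := by
  have : Module.Finite ℤ Λ := ZLattice.module_finite ℝ Λ
  have : Module.Free ℤ Λ := ZLattice.module_free ℝ Λ
  let b := Module.Free.chooseBasis ℤ Λ
  let B := b.ofZLatticeBasis ℝ Λ
  have : Nonempty (Fin d) := ⟨⟨0, hd⟩⟩
  obtain ⟨k⟩ := B.index_nonempty
  -- The coordinate functional of a lattice basis is integral on `Λ`; here it is written as a dot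
  -- product.
  have hy : ∀ x : Fin d → ℝ, ∑ i, B.coord k (Pi.single i 1) * x i = B.coord k x := by
    intro x
    conv_rhs => rw [pi_eq_sum_univ' x]
    simp [mul_comm]
  refine ⟨fun i => B.coord k (Pi.single i 1), mem_dualLattice.2 fun x hx => ?_, fun h0 => ?_⟩
  · refine ⟨b.repr ⟨x, hx⟩ k, ?_⟩
    rw [hy]
    exact (b.ofZLatticeBasis_repr_apply ℝ Λ ⟨x, hx⟩ k).symm
  · have h := hy (B k)
    simp [funext_iff] at h0
    simp [h0] at h

/-- A transference principle: a nonzero dual lattice vector in a small box forces, by Minkowski's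
convex body theorem, a nonzero lattice vector in a box polar to it. -/
theorem exists_lattice_point_of_dual_point {d : ℕ} {Λ : Submodule ℤ (Fin d → ℝ)}
    (hΛ : IsUnimodularLattice Λ) {τ : Fin d → ℝ} (hτ : ∑ i, τ i = 0) {y : Fin d → ℝ}
    (hy : y ∈ dualLattice Λ) (hy0 : y ≠ 0) {c C : ℝ} (hC : 0 < C) (hcC : c < C ^ (d - 1))
    (hyc : ∀ i, |y i| ≤ c * Real.exp (-τ i)) :
    ∃ x ∈ Λ, x ≠ 0 ∧ ∀ i, |x i| ≤ d * C * Real.exp (τ i) := by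
  have := hΛ.discrete
  have := hΛ.isZLattice
  obtain ⟨i₀, hi₀⟩ := Function.ne_iff.1 hy0
  have : Nonempty (Fin d) := ⟨i₀⟩
  -- Maximality makes `y i` dominant, so `⟨y, x⟩ = 0` will bound `x i` by the other coordinates.
  obtain ⟨i, hi⟩ := Finite.exists_max fun j => |y j| * Real.exp (τ j)
  have hyi : 0 < |y i| := by
    have h0 : 0 < |y i₀| * Real.exp (τ i₀) := mul_pos (abs_pos.2 hi₀) (Real.exp_pos _)
    exact pos_of_mul_pos_left (h0.trans_le (hi i₀)) (Real.exp_pos _).le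
  -- The constraint on `x i` is replaced by `|⟨y, x⟩| < 1`, with determinant `y i`.
  set r : Fin d → ℝ := Function.update (fun j => C * Real.exp (τ j)) i 1 with hr
  have hr0 : ∀ j, 0 < r j := fun j => by
    rcases eq_or_ne j i with rfl | hj
    · simp [hr]
    · simp only [hr, Function.update_of_ne hj]; positivity
  set M : Matrix (Fin d) (Fin d) ℝ := Matrix.updateRow 1 i y with hM
  have hMi : ∀ x, (M.mulVec x) i = ∑ j, y j * x j := fun x => by
    simp [hM, Matrix.mulVec, dotProduct]
  have hMj : ∀ x j, j ≠ i → (M.mulVec x) j = x j := fun x j hj => by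
    simp [hM, Matrix.mulVec, Matrix.updateRow_ne hj, dotProduct, Matrix.one_apply]
  have hdet : LinearMap.det (Matrix.toLin' M) = y i := by
    rw [LinearMap.det_toLin']
    have h := Matrix.det_updateRow_sum (1 : Matrix (Fin d) (Fin d) ℝ) i y
    have hsum : ∑ k, y k • (1 : Matrix (Fin d) (Fin d) ℝ) k = y := by
      ext j
      simp [Matrix.one_apply]
    rwa [hsum, Matrix.det_one, smul_eq_mul, mul_one] at h
  set s : Set (Fin d → ℝ) :=
    Matrix.toLin' M ⁻¹' Set.univ.pi fun j => Set.Ioo (-r j) (r j) with hs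
  have hprod : ∏ j, (r j - -r j) = 2 ^ d * (C ^ (d - 1) * Real.exp (-τ i)) := by
    have h1 : ∏ j, (r j - -r j) = 2 ^ d * ∏ j, r j := by
      simp_rw [sub_neg_eq_add, ← two_mul, Finset.prod_mul_distrib]
      simp
    have h2 : Real.exp (-τ i) = ∏ j ∈ Finset.univ \ {i}, Real.exp (τ j) := by
      rw [← Real.exp_sum]
      congr 1
      have := Finset.sum_sdiff (f := τ) (Finset.subset_univ {i})
      rw [hτ, Finset.sum_singleton] at this
      linarith
    rw [h1, hr, Finset.prod_update_of_mem (Finset.mem_univ i), one_mul,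
      Finset.prod_mul_distrib, Finset.prod_const, ← h2]
    congr 3
    simp [Finset.card_sdiff]
  have hvol : MeasureTheory.volume s =
      ENNReal.ofReal (|(y i)⁻¹| * (2 ^ d * (C ^ (d - 1) * Real.exp (-τ i)))) := by
    rw [hs, MeasureTheory.Measure.addHaar_preimage_linearMap _
      (by rw [hdet]; exact abs_pos.1 hyi), hdet, Real.volume_pi_Ioo,
      ← ENNReal.ofReal_prod_of_nonneg (fun j _ => by linarith [hr0 j]), hprod,
      ← ENNReal.ofReal_mul (abs_nonneg _)]
  let b := Module.Free.chooseBasis ℤ Λ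
  have fund := ZLattice.isAddFundamentalDomain b
    (MeasureTheory.volume : MeasureTheory.Measure (Fin d → ℝ))
  have hcov := ZLattice.covolume_eq_measure_fundamentalDomain Λ MeasureTheory.volume fund
  rw [hΛ.covolume_eq_one] at hcov
  have hF : MeasureTheory.volume (ZSpan.fundamentalDomain (b.ofZLatticeBasis ℝ)) = 1 := by
    rw [MeasureTheory.Measure.real, eq_comm, ENNReal.toReal_eq_one_iff] at hcov
    exact hcov
  have : Countable Λ.toAddSubgroup := inferInstanceAs (Countable Λ)
  obtain ⟨x, hx0, hxs⟩ :=
    MeasureTheory.exists_ne_zero_mem_lattice_of_measure_mul_two_pow_lt_measure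
      (L := Λ.toAddSubgroup) (s := s) fund
      (fun x hx j _ => by
        have := hx j trivial
        simp only [Set.mem_Ioo, map_neg, Pi.neg_apply] at this ⊢
        constructor <;> linarith [this.1, this.2])
      ((convex_pi fun j _ => convex_Ioo _ _).linear_preimage _)
      (by
        rw [hF, one_mul, hvol, Module.finrank_fin_fun,
          show (2 : ENNReal) ^ d = ENNReal.ofReal (2 ^ d) by
            rw [ENNReal.ofReal_pow (by norm_num)]; norm_num,
          ENNReal.ofReal_lt_ofReal_iff_of_nonneg (by positivity), abs_inv,
          lt_inv_mul_iff₀ hyi, mul_comm]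
        gcongr
        exact (hyc i).trans_lt (by gcongr))
  have hxj : ∀ j, j ≠ i → |(x : Fin d → ℝ) j| < C * Real.exp (τ j) := fun j hj => by
    have h := hxs j trivial
    simp only [Matrix.toLin'_apply, hMj _ j hj, hr, Function.update_of_ne hj] at h
    exact abs_lt.2 h
  -- An integer strictly between `-1` and `1` vanishes.
  have hxi : ∑ j, y j * (x : Fin d → ℝ) j = 0 := by
    have h := hxs i trivial
    simp only [Matrix.toLin'_apply, hMi, hr, Function.update_self] at h
    obtain ⟨n, hn⟩ := mem_dualLattice.1 hy x x.2
    rw [← hn] at h ⊢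
    have h1 : (-1 : ℤ) < n := by exact_mod_cast h.1
    have h2 : n < (1 : ℤ) := by exact_mod_cast h.2
    exact_mod_cast (by omega : n = 0)
  refine ⟨x, x.2, fun h => hx0 (Subtype.ext h), fun j => ?_⟩
  have hd1 : (1 : ℝ) ≤ d := by exact_mod_cast Fin.pos i
  rcases eq_or_ne j i with rfl | hj
  · rw [← Finset.add_sum_erase _ _ (Finset.mem_univ j)] at hxi
    have hle : |y j| * |(x : Fin d → ℝ) j| ≤
        ∑ k ∈ Finset.univ.erase j, |y j| * Real.exp (τ j) * C := by
      rw [← abs_mul, eq_neg_of_add_eq_zero_left hxi, abs_neg]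
      refine (Finset.abs_sum_le_sum_abs _ _).trans (Finset.sum_le_sum fun k hk => ?_)
      rw [abs_mul]
      calc |y k| * |(x : Fin d → ℝ) k| ≤ |y k| * (C * Real.exp (τ k)) := by
            gcongr
            exact (hxj k (Finset.ne_of_mem_erase hk)).le
        _ = |y k| * Real.exp (τ k) * C := by ring
        _ ≤ _ := mul_le_mul_of_nonneg_right (hi k) hC.le
    rw [Finset.sum_const, nsmul_eq_mul, mul_assoc (|y j|), mul_left_comm] at hle
    refine (le_of_mul_le_mul_left hle hyi).trans ?_
    rw [mul_assoc, mul_comm C]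
    gcongr
    simp
  · refine (hxj j hj).le.trans ?_
    gcongr
    exact le_mul_of_one_le_left hC.le hd1

/-- The logarithmic form of the transference inequality between the first minima of a unimodular
lattice and of its dual. -/
theorem logMin_le_logMin_dualLattice {d : ℕ} (hd : 2 ≤ d) {Λ : Submodule ℤ (Fin d → ℝ)}
    (hΛ : IsUnimodularLattice Λ) (τ : traceZero d) :
    ((d : ℝ) - 1) * (logMin 1 (-τ) Λ - Real.log (2 * d)) ≤ logMin 1 τ (dualLattice Λ) := by
  have := hΛ.discrete
  have := hΛ.isZLattice
  have hd0 : (0 : ℝ) < d := by exact_mod_cast (by omega : 0 < d)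
  have hτ : ∑ i, (-(τ : Fin d → ℝ)) i = 0 := by
    have : ∑ i, (τ : Fin d → ℝ) i = 0 := τ.2
    simp [this]
  rw [logMin, logMin, successiveMin_one_paramBox, successiveMin_one_paramBox, Submodule.coe_neg]
  set S := {c : ℝ | 0 < c ∧ ∃ x ∈ Λ, x ≠ 0 ∧ ∀ i, |x i| ≤ c * Real.exp ((-(τ : Fin d → ℝ)) i)}
    with hS
  set T := {c : ℝ | 0 < c ∧ ∃ x ∈ dualLattice Λ, x ≠ 0 ∧
    ∀ i, |x i| ≤ c * Real.exp ((τ : Fin d → ℝ) i)} with hT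
  have hTS : ∀ c ∈ T, ∀ C : ℝ, 0 < C → c < C ^ (d - 1) → d * C ∈ S := by
    rintro c ⟨-, y, hy, hy0, hyc⟩ C hC hcC
    exact ⟨by positivity, exists_lattice_point_of_dual_point hΛ hτ hy hy0 hC hcC
      (by simpa using hyc)⟩
  have hTne : T.Nonempty := by
    obtain ⟨y, hy, hy0⟩ := exists_ne_zero_mem_dualLattice (by omega : 0 < d) Λ
    refine ⟨‖y‖ * Real.exp ‖(τ : Fin d → ℝ)‖, by positivity, y, hy, hy0, fun i => ?_⟩
    rw [mul_assoc, ← Real.exp_add]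
    refine (norm_le_pi_norm y i).trans (le_mul_of_one_le_right (norm_nonneg _) ?_)
    rw [Real.one_le_exp_iff]
    linarith [neg_abs_le ((τ : Fin d → ℝ) i), norm_le_pi_norm (τ : Fin d → ℝ) i,
      Real.norm_eq_abs ((τ : Fin d → ℝ) i)]
  have hSne : S.Nonempty := by
    obtain ⟨c, hc⟩ := hTne
    refine ⟨_, hTS c hc (c + 1) (by linarith [hc.1]) ?_⟩
    exact (lt_add_one c).trans_le (le_self_pow₀ (by linarith [hc.1]) (by omega))
  have hSpos : 0 < sInf S := by
    obtain ⟨ε, hε, h⟩ := exists_pos_le_of_discrete (-(τ : Fin d → ℝ)) Λ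
    exact hε.trans_le (le_csInf hSne fun c ⟨hc, x, hx, hx0, hxc⟩ => h c hc x hx hx0 hxc)
  have hSbdd : BddBelow S := ⟨0, fun c hc => hc.1.le⟩
  -- Taking `C = sInf S / (2 * d)` would put `sInf S / 2` in `S`; the factor `2` makes this a
  -- contradiction.
  have hpow : (sInf S / (2 * d)) ^ (d - 1) ≤ sInf T := by
    refine le_csInf hTne fun c hc => ?_
    by_contra! hlt
    have h := csInf_le hSbdd (hTS c hc _ (by positivity) hlt)
    have : (d : ℝ) * (sInf S / (2 * d)) = sInf S / 2 := by field_simp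
    linarith
  have hlog := Real.log_le_log (by positivity) hpow
  rwa [Real.log_pow, Real.log_div hSpos.ne' (by positivity), Nat.cast_sub (by omega),
    Nat.cast_one] at hlog

/-- A function with bounded sublevel sets tends to infinity at infinity. -/
theorem IsExhaustionFunction.tendsto_atTop {d : ℕ} {f : traceZero d → ℝ}
    (hf : IsExhaustionFunction f) :
    Filter.Tendsto f (Bornology.cobounded (traceZero d)) Filter.atTop := by
  refine Filter.tendsto_atTop.2 fun c => ?_
  filter_upwards [Bornology.isBounded_def.1 (hf.isBounded_sublevel c)] with τ hτ
  exact (not_le.1 (Set.mem_compl_iff _ _ |>.1 hτ)).le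

theorem theoremt (d : ℕ) (hd : 2 ≤ d) (Λ : Submodule ℤ (Fin d → ℝ))
    (hΛ : IsUnimodularLattice Λ) (f : traceZero d → ℝ) (hf : IsExhaustionFunction f) :
    lowerPsi 1 Λ f ≤ lowerPsi 1 (dualLattice Λ) (conjFun f) / (((d : ℝ) - 1 : ℝ) : EReal) := by
  have hd1 : (0 : ℝ) < (d : ℝ) - 1 := by
    have : (2 : ℝ) ≤ d := by exact_mod_cast hd
    linarith
  refine EReal.le_of_forall_lt_iff_le.1 fun z hz => ?_
  obtain ⟨a, hLa, haz⟩ := EReal.lt_iff_exists_real_btwn.1 hz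
  have haz : a < z := by exact_mod_cast haz
  rw [EReal.div_lt_iff (by exact_mod_cast hd1) (EReal.coe_ne_top _), ← EReal.coe_mul] at hLa
  have hfreq := Filter.frequently_lt_of_liminf_lt (by isBoundedDefault) hLa
  have htend : Filter.Tendsto (fun τ => f (-τ)) (Bornology.cobounded (traceZero d))
      Filter.atTop := hf.tendsto_atTop.comp Filter.tendsto_neg_cobounded
  -- Beyond this threshold the gap `z - a` absorbs the error: `log (2 * d) ≤ (z - a) * f (-τ)`.
  have hev := (htend.eventually_ge_atTop (Real.log (2 * d) / (z - a))).and
    (htend.eventually_gt_atTop 0)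
  -- The dual is sampled at `τ` and `Λ` at `-τ`; negation preserves going to infinity.
  refine Filter.liminf_le_of_frequently_le' (Filter.tendsto_neg_cobounded.frequently
    ((hfreq.and_eventually hev).mono ?_))
  rintro τ ⟨hτ, hlarge, hpos⟩
  simp only [PsiFun, psiFun, conjFun, Finset.Icc_self, Finset.sum_singleton,
    EReal.coe_lt_coe_iff, EReal.coe_le_coe_iff] at hτ ⊢
  rw [div_lt_iff₀ hpos] at hτ
  rw [div_le_iff₀ hpos]
  rw [div_le_iff₀ (by linarith)] at hlarge
  have h := (logMin_le_logMin_dualLattice hd hΛ τ).trans_lt hτ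
  rw [mul_comm a, mul_assoc, mul_lt_mul_iff_right₀ hd1] at h
  linarith
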